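/- **Setting.** Let $\mathfrak R$ be a hyperfinite factor of type $\mathrm{II}_\infty$ acting on a separable Hilbert space, with a faithful normal semifinite trace $\mathrm{tr}$. Tensor products of von Neumann algebras are von Neumann tensor products. A *pseudo-trace* on a von Neumann algebra $\mathfrak A$ is a $\sigma$-weakly continuous linear form $\alpha:\mathfrak A\to\mathbb C$ which is hermitian ($\alpha(x)=\overline{\alpha(x^*)}$), tracial ($\alpha(xy)=\alpha(yx)$) and faithful (if $\alpha(xy)=0$ for all $y\in\mathfrak A$, then $x=0$); it need not be positive. Let $p\in\mathfrak R$ be a finite projection. A *hyperfinite project* $\mathfrak a=a\cdot+\cdot\alpha+A$ of carrier $p$ consists of a wager $a\in\mathbb R\cup\{\infty\}$, a dialect $\mathfrak A$, which is a finite von Neumann algebra of type $\mathrm I$ (on a separable Hilbert space), a pseudo-trace $\alpha$ on $\mathfrak A$, and a hermitian operator $A\in p\mathfrak Rp\otimes\mathfrak A$ with $\|A\|\le 1$. Given projects $\mathfrak a=a\cdot+\cdot\alpha+A$ and $\mathfrak b=b\cdot+\cdot\beta+B$ of carrier $p$ and dialects $\mathfrak A$, $\mathfrak B$, let $A^\dagger,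 B^\ddagger\in\mathfrak R\otimes\mathfrak A\otimes\mathfrak B$ be the images of $A$ and $B$ under $x\otimes u\mapsto x\otimes u\otimes 1$ and $x\otimes v\mapsto x\otimes 1\otimes v$ respectively. With $r$ denoting the spectral radius, their *measurement* is $$\langle\mathfrak a,\mathfrak b\rangle=\alpha(1)\,b+\beta(1)\,a+[A,B],\qquad [A,B]=\begin{cases}\displaystyle\sum_{k=1}^{\infty}\frac{(\mathrm{tr}\otimes\alpha\otimes\beta)\big((A^\dagger B^\ddagger)^k\big)}{k}&\text{if } r(A^\dagger B^\ddagger)<1,\\ \infty&\text{otherwise,}\end{cases}$$ computed in $\mathbb R\cup\{\infty\}$, with $0\cdot\infty=0$ and $\lambda\cdot\infty=\infty$ for every real $\lambda\neq0$. The projects $\mathfrak a$ and $\mathfrak b$ are *orthogonal* if $\langle\mathfrak a,\mathfrak b\rangle\neq 0,\infty$. For a set $\mathbf A$ of projects of carrier $p$, its orthogonal $\mathbf A^\perp$ is the set of the projects of carrier $p$ orthogonal to every element of $\mathbf A$; $\mathbf A$ is a *conduct* of carrier $p$ if $\mathbf A=\mathbf A^{\perp\perp}$. An *outlook* is a maximal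 abelian von Neumann subalgebra (MASA) $\mathfrak P$ of $\mathfrak R$. The *normalising groupoid* of a subalgebra $\mathfrak C$ of $\mathfrak N$ is the set of the $u\in\mathfrak N$ with $uu^*u=u$, $uu^*\in\mathfrak C$, $u^*u\in\mathfrak C$ and $u\mathfrak Cu^*\subseteq\mathfrak C$. The *normaliser algebra* $\mathcal N_{\mathfrak N}(\mathfrak C)$ is the von Neumann algebra generated by the unitaries $u\in\mathfrak N$ with $u\mathfrak Cu^*=\mathfrak C$. A project $\mathfrak a=a\cdot+\cdot\alpha+A$ of dialect $\mathfrak A$ is *promising with respect to $\mathfrak P$* if - $\mathfrak A$ is a finite factor, i.e. $*$-isomorphic to a matrix algebra $M_n(\mathbb C)$ with $n\ge1$, and $\alpha$ is its normalised trace; - $a=0$; - there is a MASA $\mathfrak Q$ of $\mathfrak A$ such that $A$ is a partial symmetry (a hermitian partial isometry) in the normalising groupoid of $\mathfrak P\otimes\mathfrak Q$ in $\mathfrak R\otimes\mathfrak A$, and $(\mathrm{tr}\otimes\alpha)(\pi A)=0$ for every projection $\pi\in\mathfrak P\otimes\mathcal N_{\mathfrak A}(\mathfrak Q)$. **Proposition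 (Coherence).** Let $\mathfrak P$ be an outlook and let $\mathbf A$ be a conduct of carrier $p$. Then $\mathbf A$ and $\mathbf A^\perp$ do not both contain a project that is promising with respect to $\mathfrak P$. -/

import Mathlib

open scoped TensorProduct ENNReal
open UniformSpace (Completion)

universe u v w

noncomputable section

namespace MatGoI

/-! ### The σ-weak topology, projections, factors -/

section Algebras

variable {H : Type u} [NormedAddCommGroup H] [InnerProductSpace ℂ H] [CompleteSpace H]

/-- The σ-weak topology on `B(H)`: the weak-star topology given by the trace class operators,
that is, the coarsest topology making all the forms `x ↦ ∑ₙ ⟪ξₙ, x ηₙ⟫` with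
`∑ ‖ξₙ‖² < ∞`, `∑ ‖ηₙ‖² < ∞` continuous. -/
@[reducible] def sigmaWeak (H : Type u) [NormedAddCommGroup H] [InnerProductSpace ℂ H] :
    TopologicalSpace (H →L[ℂ] H) :=
  ⨅ (ξ : ℕ → H) (η : ℕ → H) (_ : Summable fun n => ‖ξ n‖ ^ 2) (_ : Summable fun n => ‖η n‖ ^ 2),
    TopologicalSpace.induced (fun x : H →L[ℂ] H => ∑' n, inner ℂ (ξ n) (x (η n))) inferInstance

/-- `p` is a projection of the von Neumann algebra `M`. -/
def IsProj (M : VonNeumannAlgebra H) (p : H →L[ℂ] H) : Prop :=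
  p ∈ M ∧ IsStarProjection p

/-- Murray–von Neumann equivalence of `p` and `q` in `M`. -/
def MvNEquiv (M : VonNeumannAlgebra H) (p q : H →L[ℂ] H) : Prop :=
  ∃ u ∈ M, u * star u = p ∧ star u * u = q

/-- `p` is equivalent in `M` to a subprojection of `q`. -/
def MvNLe (M : VonNeumannAlgebra H) (p q : H →L[ℂ] H) : Prop :=
  ∃ r, IsProj M r ∧ r * q = r ∧ MvNEquiv M p r

/-- `p` is a finite projection of `M`: a projection which is not equivalent to a proper
subprojection of itself. -/
def IsFiniteProj (M : VonNeumannAlgebra H) (p : H →L[ℂ] H) : Prop :=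
  IsProj M p ∧ ∀ r, IsProj M r → r * p = r → MvNEquiv M r p → r = p

/-- `M` is a factor: its center is reduced to the scalars. -/
def IsFactor (M : VonNeumannAlgebra H) : Prop :=
  ∀ z ∈ M, z ∈ M.commutant → ∃ c : ℂ, z = c • (1 : H →L[ℂ] H)

/-- `M` is a factor of type II_∞: the equivalence classes of its projections, ordered by
`MvNLe`, are order isomorphic to `[0, ∞]`, where `∞` stands for the infinite projections. -/
def IsFactorIIInfty (M : VonNeumannAlgebra H) : Prop :=
  IsFactor M ∧ ∃ d : (H →L[ℂ] H) → ℝ≥0∞,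
    (∀ r : ℝ≥0∞, ∃ p, IsProj M p ∧ d p = r) ∧
    (∀ p q, IsProj M p → IsProj M q → (d p ≤ d q ↔ MvNLe M p q)) ∧
    (∀ p, IsProj M p → (d p = ⊤ ↔ ¬ IsFiniteProj M p))

/-- `M` is hyperfinite: it is the σ-weak closure of the union of a directed family of
finite-dimensional `*`-subalgebras. -/
def IsHyperfinite (M : VonNeumannAlgebra H) : Prop :=
  ∃ F : Set (StarSubalgebra ℂ (H →L[ℂ] H)), F.Nonempty ∧ DirectedOn (· ≤ ·) F ∧
    (∀ S ∈ F, FiniteDimensional ℂ S ∧ (S : Set (H →L[ℂ] H)) ⊆ M) ∧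
    (M : Set (H →L[ℂ] H)) ⊆
      @closure _ (sigmaWeak H) (⋃ S ∈ F, (S : Set (H →L[ℂ] H)))

/-- `tr : M⁺ → [0, ∞]` is a faithful normal semifinite trace on `M`
(only the values of `tr` on positive elements of `M` are relevant). -/
structure IsTrace (M : VonNeumannAlgebra H) (tr : (H →L[ℂ] H) → ℝ≥0∞) : Prop where
  add : ∀ x ∈ M, ∀ y ∈ M, 0 ≤ x → 0 ≤ y → tr (x + y) = tr x + tr y
  smul : ∀ x ∈ M, 0 ≤ x → ∀ c : NNReal, tr (((c : ℝ) : ℂ) • x) = c * tr x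
  tracial : ∀ x ∈ M, tr (star x * x) = tr (x * star x)
  faithful : ∀ x ∈ M, 0 ≤ x → x ≠ 0 → 0 < tr x
  semifinite : ∀ x ∈ M, 0 ≤ x → x ≠ 0 → ∃ y ∈ M, 0 ≤ y ∧ y ≤ x ∧ y ≠ 0 ∧ tr y < ⊤
  normal : ∀ (S : Set (H →L[ℂ] H)) (x : H →L[ℂ] H), S.Nonempty → DirectedOn (· ≤ ·) S →
    (∀ y ∈ S, y ∈ M ∧ 0 ≤ y) → x ∈ M → IsLUB S x → tr x = ⨆ y ∈ S, tr y

/-- `A` is abelian. -/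
def IsAbelian (A : VonNeumannAlgebra H) : Prop :=
  ∀ x ∈ A, ∀ y ∈ A, x * y = y * x

/-- `A` is a maximal abelian (von Neumann) subalgebra of `M`. -/
def IsMASA (A M : VonNeumannAlgebra H) : Prop :=
  A ≤ M ∧ IsAbelian A ∧ ∀ B : VonNeumannAlgebra H, A ≤ B → B ≤ M → IsAbelian B → A = B

/-- `M` is finite: its unit is a finite projection. -/
def IsFiniteVN (M : VonNeumannAlgebra H) : Prop :=
  IsFiniteProj M 1

/-- `M` is of type I: every nonzero central projection majorizes a nonzero abelian projection. -/
def IsTypeI (M : VonNeumannAlgebra H) : Prop :=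
  ∀ z, IsProj M z → z ∈ M.commutant → z ≠ 0 →
    ∃ e, IsProj M e ∧ e ≠ 0 ∧ e * z = e ∧
      ∀ x ∈ M, ∀ y ∈ M, (e * x * e) * (e * y * e) = (e * y * e) * (e * x * e)

/-- A pseudo-trace on `M`: a hermitian, tracial, faithful (in the sense that
`(x, y) ↦ α (x * y)` is nondegenerate; it is not assumed positive) and normal linear form. -/
structure IsPseudoTrace (M : VonNeumannAlgebra H) (α : M.toStarSubalgebra →ₗ[ℂ] ℂ) : Prop where
  hermitian : ∀ x, α x = starRingEnd ℂ (α (star x))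
  tracial : ∀ x y, α (x * y) = α (y * x)
  faithful : ∀ x, (∀ y, α (x * y) = 0) → x = 0
  normal : @Continuous _ _ (TopologicalSpace.induced Subtype.val (sigmaWeak H)) inferInstance α

/-- The corner `p M p`. -/
def corner (M : VonNeumannAlgebra H) (p : H →L[ℂ] H) : Set (H →L[ℂ] H) :=
  {x | ∃ y ∈ M, x = p * y * p}

/-- The normalising groupoid of `A` in `N`. -/
def normalisingGroupoid (N A : Set (H →L[ℂ] H)) : Set (H →L[ℂ] H) :=
  {x | x ∈ N ∧ x * star x * x = x ∧ x * star x ∈ A ∧ star x * x ∈ A ∧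
    ∀ a ∈ A, x * a * star x ∈ A}

/-- The normaliser of `A` in `N`: the unitaries `x` of `N` such that `x A x* = A`. -/
def normaliser (N A : Set (H →L[ℂ] H)) : Set (H →L[ℂ] H) :=
  {x | x ∈ N ∧ x ∈ unitary (H →L[ℂ] H) ∧ (fun a => x * a * star x) '' A = A}

/-- The von Neumann algebra generated by the normaliser of `A` in `N`
(the bicommutant of this group of unitaries). -/
def normaliserAlgebra (N A : Set (H →L[ℂ] H)) : Set (H →L[ℂ] H) :=
  Set.centralizer (Set.centralizer (normaliser N A))

/-- Partial symmetries: hermitian partial isometries. -/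
def IsPartialSymmetry (x : H →L[ℂ] H) : Prop :=
  star x = x ∧ x * star x * x = x

end Algebras

/-! ### Tensor products -/

section Tensor

variable {H : Type u} [NormedAddCommGroup H] [InnerProductSpace ℂ H]
variable {K : Type v} [NormedAddCommGroup K] [InnerProductSpace ℂ K]
variable {L : Type w} [NormedAddCommGroup L] [InnerProductSpace ℂ L]

/-- The Hilbert tensor product: the completion of the algebraic tensor product. -/
def HTensor (H : Type u) [NormedAddCommGroup H] [InnerProductSpace ℂ H]
    (K : Type v) [NormedAddCommGroup K] [InnerProductSpace ℂ K] : Type (max u v) :=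
  Completion (H ⊗[ℂ] K)

instance : NormedAddCommGroup (HTensor H K) :=
  inferInstanceAs (NormedAddCommGroup (Completion (H ⊗[ℂ] K)))

instance : InnerProductSpace ℂ (HTensor H K) :=
  inferInstanceAs (InnerProductSpace ℂ (Completion (H ⊗[ℂ] K)))

instance : CompleteSpace (HTensor H K) :=
  inferInstanceAs (CompleteSpace (Completion (H ⊗[ℂ] K)))

/-- The inclusion of the algebraic tensor product in its completion. -/
def toH (H : Type u) [NormedAddCommGroup H] [InnerProductSpace ℂ H]
    (K : Type v) [NormedAddCommGroup K] [InnerProductSpace ℂ K] : H ⊗[ℂ] K →L[ℂ] HTensor H K :=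
  (Completion.toComplL : H ⊗[ℂ] K →L[ℂ] Completion (H ⊗[ℂ] K))

/-- The continuous extension to the Hilbert tensor product. -/
def extendH {E : Type*} [NormedAddCommGroup E] [InnerProductSpace ℂ E] [CompleteSpace E]
    (f : H ⊗[ℂ] K →L[ℂ] E) : HTensor H K →L[ℂ] E :=
  (f.fromCompletion : Completion (H ⊗[ℂ] K) →L[ℂ] E)

/-- The operator `x ⊗ a` on the Hilbert tensor product. -/
def opTensor (x : H →L[ℂ] H) (a : K →L[ℂ] K) : HTensor H K →L[ℂ] HTensor H K :=
  extendH (toH H K ∘L TensorProduct.mapL x a)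

/-- The von Neumann tensor product of `S` and `T`: the σ-weak closure of the linear span of the
`x ⊗ a`, with `x` in `S` and `a` in `T`. -/
def vnTensor (S : Set (H →L[ℂ] H)) (T : Set (K →L[ℂ] K)) :
    Set (HTensor H K →L[ℂ] HTensor H K) :=
  @closure _ (sigmaWeak (HTensor H K))
    (Submodule.span ℂ {z | ∃ x ∈ S, ∃ a ∈ T, z = opTensor x a} :
      Set (HTensor H K →L[ℂ] HTensor H K))

/-- The simple tensor `h ⊗ k` as an element of the Hilbert tensor product. -/
def tmulH (h : H) (k : K) : HTensor H K :=
  toH H K (h ⊗ₜ[ℂ] k)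

theorem toH_tmul (h : H) (k : K) : toH H K (h ⊗ₜ[ℂ] k) = tmulH h k := rfl

theorem extendH_toH {E : Type*} [NormedAddCommGroup E] [InnerProductSpace ℂ E] [CompleteSpace E]
    (f : H ⊗[ℂ] K →L[ℂ] E) (t : H ⊗[ℂ] K) : extendH f (toH H K t) = f t :=
  ContinuousLinearMap.fromCompletion_apply_coe f t

theorem extendH_tmulH {E : Type*} [NormedAddCommGroup E] [InnerProductSpace ℂ E]
    [CompleteSpace E] (f : H ⊗[ℂ] K →L[ℂ] E) (h : H) (k : K) :
    extendH f (tmulH h k) = f (h ⊗ₜ[ℂ] k) :=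
  extendH_toH f _

theorem opTensor_tmulH (x : H →L[ℂ] H) (a : K →L[ℂ] K) (h : H) (k : K) :
    opTensor x a (tmulH h k) = tmulH (x h) (a k) := by
  rw [opTensor, extendH_tmulH]
  rfl

theorem tmulH_add_left (h h' : H) (k : K) : tmulH (h + h') k = tmulH h k + tmulH h' k :=
  (congrArg (toH H K) (TensorProduct.add_tmul h h' k)).trans (map_add (toH H K) _ _)

theorem tmulH_add_right (h : H) (k k' : K) : tmulH h (k + k') = tmulH h k + tmulH h k' :=
  (congrArg (toH H K) (TensorProduct.tmul_add h k k')).trans (map_add (toH H K) _ _)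

theorem tmulH_smul_left (c : ℂ) (h : H) (k : K) : tmulH (c • h) k = c • tmulH h k :=
  map_smul (toH H K) c (h ⊗ₜ[ℂ] k)

theorem tmulH_smul_right (c : ℂ) (h : H) (k : K) : tmulH h (c • k) = c • tmulH h k :=
  (congrArg (toH H K) (TensorProduct.tmul_smul c h k)).trans (map_smul (toH H K) c _)

theorem inner_tmulH (h h' : H) (k k' : K) :
    inner ℂ (tmulH h k) (tmulH h' k') = inner ℂ h h' * inner ℂ k k' :=
  Completion.inner_coe (𝕜 := ℂ) (h ⊗ₜ[ℂ] k) (h' ⊗ₜ[ℂ] k')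

/-- A closed property that is stable under sums and holds for simple tensors always holds. -/
theorem htensor_induction {P : HTensor H K → Prop} (hc : IsClosed {t | P t}) (h0 : P 0)
    (ht : ∀ h k, P (tmulH h k)) (ha : ∀ s t, P s → P t → P (s + t)) (t : HTensor H K) : P t := by
  refine Completion.induction_on (p := P) t hc fun a => ?_
  change P (toH H K a)
  induction a using TensorProduct.induction_on with
  | zero => exact (map_zero (toH H K)).symm ▸ h0
  | tmul h k => exact ht h k
  | add x y hx hy => exact (map_add (toH H K) x y).symm ▸ ha _ _ hx hy

/-- The operator `h ↦ h ⊗ l`. -/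
def rightLeg (H : Type u) [NormedAddCommGroup H] [InnerProductSpace ℂ H] (l : L) :
    H →L[ℂ] HTensor H L :=
  toH H L ∘L (TensorProduct.mkL ℂ H L).flip l

/-- The operator `h ⊗ k ↦ (h ⊗ l) ⊗ k`. -/
def midLeg (H : Type u) [NormedAddCommGroup H] [InnerProductSpace ℂ H]
    (K : Type v) [NormedAddCommGroup K] [InnerProductSpace ℂ K] (l : L) :
    HTensor H K →L[ℂ] HTensor (HTensor H L) K :=
  extendH (toH (HTensor H L) K ∘L
    TensorProduct.mapL (rightLeg H l) (ContinuousLinearMap.id ℂ K))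

theorem midLeg_tmulH (l : L) (h : H) (k : K) :
    midLeg H K l (tmulH h k) = tmulH (tmulH h l) k := by
  rw [midLeg, extendH_tmulH]
  rfl

theorem midLeg_add (l l' : L) (t : HTensor H K) :
    midLeg H K (l + l') t = midLeg H K l t + midLeg H K l' t := by
  induction t using htensor_induction with
  | hc => exact isClosed_eq (by fun_prop) (by fun_prop)
  | h0 => simp
  | ht h k => simp only [midLeg_tmulH, tmulH_add_right, tmulH_add_left]
  | ha s t hs ht => simp only [map_add, hs, ht]; abel

theorem htensor_ext {E : Type*} [NormedAddCommGroup E] [NormedSpace ℂ E]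
    {f g : HTensor H K →L[ℂ] E} (h : ∀ x y, f (tmulH x y) = g (tmulH x y)) : f = g := by
  ext t
  induction t using htensor_induction with
  | hc => exact isClosed_eq f.continuous g.continuous
  | h0 => rw [map_zero, map_zero]
  | ht x y => exact h x y
  | ha s t hs ht => rw [map_add, map_add, hs, ht]

theorem midLeg_smul (c : ℂ) (l : L) (t : HTensor H K) :
    midLeg H K (c • l) t = c • midLeg H K l t := by
  have h : midLeg H K (c • l) = c • midLeg H K l := by
    refine htensor_ext fun x y => ?_
    rw [smul_apply, midLeg_tmulH, midLeg_tmulH, tmulH_smul_right,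
      tmulH_smul_left]
  rw [h, smul_apply]

theorem inner_midLeg (l l' : L) (s t : HTensor H K) :
    inner ℂ (midLeg H K l s) (midLeg H K l' t) = inner ℂ s t * inner ℂ l l' := by
  induction s using htensor_induction with
  | hc => exact isClosed_eq (by fun_prop) (by fun_prop)
  | h0 => simp
  | ha s s' hs hs' => simp only [map_add, inner_add_left, hs, hs']; ring
  | ht h k =>
    induction t using htensor_induction with
    | hc => exact isClosed_eq (by fun_prop) (by fun_prop)
    | h0 => simp
    | ha t t' ht ht' => simp only [map_add, inner_add_right, ht, ht']; ring
    | ht h' k' => simp only [midLeg_tmulH, inner_tmulH]; ring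

/-- The exchange `(h ⊗ k) ⊗ l ↦ (h ⊗ l) ⊗ k` before the last completion. -/
def swapLin (H : Type u) [NormedAddCommGroup H] [InnerProductSpace ℂ H]
    (K : Type v) [NormedAddCommGroup K] [InnerProductSpace ℂ K]
    (L : Type w) [NormedAddCommGroup L] [InnerProductSpace ℂ L] :
    HTensor H K ⊗[ℂ] L →ₗ[ℂ] HTensor (HTensor H L) K :=
  TensorProduct.lift (LinearMap.mk₂ ℂ (fun t l => midLeg H K l t)
    (fun s t l => map_add _ s t) (fun c t l => map_smul _ c t)
    (fun t l l' => midLeg_add l l' t) (fun c t l => midLeg_smul c l t))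

theorem swapLin_tmul (t : HTensor H K) (l : L) :
    swapLin H K L (t ⊗ₜ[ℂ] l) = midLeg H K l t := rfl

theorem inner_swapLin (s t : HTensor H K ⊗[ℂ] L) :
    inner ℂ (swapLin H K L s) (swapLin H K L t) = inner ℂ s t := by
  induction s using TensorProduct.induction_on with
  | zero => rw [map_zero, inner_zero_left]; exact (inner_zero_left t).symm
  | add s s' hs hs' =>
    rw [map_add, inner_add_left, hs, hs']
    exact (inner_add_left s s' t).symm
  | tmul u l =>
    induction t using TensorProduct.induction_on with
    | zero => rw [map_zero, inner_zero_right]; exact (inner_zero_right _).symm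
    | add t t' ht ht' =>
      rw [map_add, inner_add_right, ht, ht']
      exact (inner_add_right _ t t').symm
    | tmul u' l' =>
      rw [swapLin_tmul, swapLin_tmul, inner_midLeg, TensorProduct.inner_tmul]

/-- The exchange unitary `(h ⊗ k) ⊗ l ↦ (h ⊗ l) ⊗ k` between iterated Hilbert tensor products. -/
def swapU (H : Type u) [NormedAddCommGroup H] [InnerProductSpace ℂ H]
    (K : Type v) [NormedAddCommGroup K] [InnerProductSpace ℂ K]
    (L : Type w) [NormedAddCommGroup L] [InnerProductSpace ℂ L] :
    HTensor (HTensor H K) L →L[ℂ] HTensor (HTensor H L) K :=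
  extendH (LinearMap.mkContinuous (swapLin H K L) 1 fun t => by
    rw [one_mul]
    refine le_of_eq ?_
    rw [@norm_eq_sqrt_re_inner ℂ, @norm_eq_sqrt_re_inner ℂ, inner_swapLin])

theorem swapU_tmulH (h : H) (k : K) (l : L) :
    swapU H K L (tmulH (tmulH h k) l) = tmulH (tmulH h l) k := by
  rw [swapU, extendH_tmulH]
  exact midLeg_tmulH l h k

/-- `A† = A ⊗ 1`, acting on `(H ⊗ K) ⊗ L`, for `A` acting on `H ⊗ K`. -/
def dagger (L : Type w) [NormedAddCommGroup L] [InnerProductSpace ℂ L]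
    (A : HTensor H K →L[ℂ] HTensor H K) :
    HTensor (HTensor H K) L →L[ℂ] HTensor (HTensor H K) L :=
  opTensor A 1

/-- `B‡`, acting on `(H ⊗ K) ⊗ L`, for `B` acting on `H ⊗ L`: the operator `B ⊗ 1` on
`(H ⊗ L) ⊗ K` transported by the exchange of the last two factors. -/
def ddagger (K : Type v) [NormedAddCommGroup K] [InnerProductSpace ℂ K]
    (B : HTensor H L →L[ℂ] HTensor H L) :
    HTensor (HTensor H K) L →L[ℂ] HTensor (HTensor H K) L :=
  swapU H L K ∘L (opTensor B 1 ∘L swapU H K L)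

end Tensor

/-! ### Product forms -/

section Forms

variable {H : Type u} [NormedAddCommGroup H] [InnerProductSpace ℂ H] [CompleteSpace H]
variable {K : Type v} [NormedAddCommGroup K] [InnerProductSpace ℂ K] [CompleteSpace K]
variable {L : Type w} [NormedAddCommGroup L] [InnerProductSpace ℂ L] [CompleteSpace L]

/-- `φ` is a σ-weakly continuous linear form that restricts to `tr(p · p) ⊗ α` on `M ⊗ A`
(hence to `tr ⊗ α` on `pMp ⊗ A`). As `M` is spanned by its positive elements, this
determines `φ` on `M ⊗ A`. -/
def IsProductForm (M : VonNeumannAlgebra H) (tr : (H →L[ℂ] H) → ℝ≥0∞) (p : H →L[ℂ] H)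
    (A : VonNeumannAlgebra K) (α : A.toStarSubalgebra →ₗ[ℂ] ℂ)
    (φ : (HTensor H K →L[ℂ] HTensor H K) →ₗ[ℂ] ℂ) : Prop :=
  @Continuous _ _ (sigmaWeak (HTensor H K)) inferInstance φ ∧
    ∀ x ∈ M, 0 ≤ x → ∀ a : A.toStarSubalgebra,
      φ (opTensor x a) = ((tr (p * x * p)).toReal : ℂ) * α a

open Classical in
/-- The form `tr ⊗ α` on `pMp ⊗ A`, as a form on `B(H ⊗ K)` whose values outside `M ⊗ A` are
irrelevant. For a finite projection `p`, a pseudo-trace `α` and a faithful normal semifinite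
trace `tr` on a type II_∞ factor `M` it exists and is unique on `M ⊗ A`. -/
def productForm (M : VonNeumannAlgebra H) (tr : (H →L[ℂ] H) → ℝ≥0∞) (p : H →L[ℂ] H)
    (A : VonNeumannAlgebra K) (α : A.toStarSubalgebra →ₗ[ℂ] ℂ) :
    (HTensor H K →L[ℂ] HTensor H K) →ₗ[ℂ] ℂ :=
  if h : ∃ φ, IsProductForm M tr p A α φ then h.choose else 0

/-- The analogue of `IsProductForm` for `tr ⊗ α ⊗ β` and `M ⊗ A ⊗ B`. -/
def IsProductForm₃ (M : VonNeumannAlgebra H) (tr : (H →L[ℂ] H) → ℝ≥0∞) (p : H →L[ℂ] H)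
    (A : VonNeumannAlgebra K) (α : A.toStarSubalgebra →ₗ[ℂ] ℂ)
    (B : VonNeumannAlgebra L) (β : B.toStarSubalgebra →ₗ[ℂ] ℂ)
    (φ : (HTensor (HTensor H K) L →L[ℂ] HTensor (HTensor H K) L) →ₗ[ℂ] ℂ) : Prop :=
  @Continuous _ _ (sigmaWeak (HTensor (HTensor H K) L)) inferInstance φ ∧
    ∀ x ∈ M, 0 ≤ x → ∀ (a : A.toStarSubalgebra) (b : B.toStarSubalgebra),
      φ (opTensor (opTensor x (a : K →L[ℂ] K)) (b : L →L[ℂ] L)) =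
        ((tr (p * x * p)).toReal : ℂ) * α a * β b

open Classical in
/-- The form `tr ⊗ α ⊗ β` on `pMp ⊗ A ⊗ B`; see `productForm`. -/
def productForm₃ (M : VonNeumannAlgebra H) (tr : (H →L[ℂ] H) → ℝ≥0∞) (p : H →L[ℂ] H)
    (A : VonNeumannAlgebra K) (α : A.toStarSubalgebra →ₗ[ℂ] ℂ)
    (B : VonNeumannAlgebra L) (β : B.toStarSubalgebra →ₗ[ℂ] ℂ) :
    (HTensor (HTensor H K) L →L[ℂ] HTensor (HTensor H K) L) →ₗ[ℂ] ℂ :=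
  if h : ∃ φ, IsProductForm₃ M tr p A α B β φ then h.choose else 0

end Forms

/-! ### Hyperfinite projects, orthogonality, conducts, promising projects -/

section Projects

variable {H : Type u} [NormedAddCommGroup H] [InnerProductSpace ℂ H] [CompleteSpace H]

/-- A project of carrier `p` in `M`: a wager, a dialect (a finite von Neumann algebra of type I
on a separable Hilbert space), a pseudo-trace on it, and a hermitian operator of
`pMp ⊗ dialect` of norm at most one. -/
structure Project (M : VonNeumannAlgebra H) (p : H →L[ℂ] H) where
  K : Type v
  [normed : NormedAddCommGroup K]
  [innerProd : InnerProductSpace ℂ K]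
  [complete : CompleteSpace K]
  [separable : TopologicalSpace.SeparableSpace K]
  wager : WithTop ℝ
  dialect : VonNeumannAlgebra K
  dialect_finite : IsFiniteVN dialect
  dialect_typeI : IsTypeI dialect
  form : dialect.toStarSubalgebra →ₗ[ℂ] ℂ
  isPseudoTrace : IsPseudoTrace dialect form
  op : HTensor H K →L[ℂ] HTensor H K
  op_mem : op ∈ vnTensor (corner M p) (dialect : Set (K →L[ℂ] K))
  op_hermitian : star op = op
  op_norm_le : ‖op‖ ≤ 1

attribute [instance] Project.normed Project.innerProd Project.complete Project.separable

variable {M : VonNeumannAlgebra H} {p : H →L[ℂ] H}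

/-- The operator `A† B‡` of two projects. -/
def interaction (a b : Project.{u, v} M p) :
    HTensor (HTensor H a.K) b.K →L[ℂ] HTensor (HTensor H a.K) b.K :=
  dagger b.K a.op * ddagger a.K b.op

/-- `ldet(1 - A† B‡) = ∑_{k ≥ 1} (tr ⊗ α ⊗ β)((A† B‡)ᵏ) / k`. -/
def ldet (tr : (H →L[ℂ] H) → ℝ≥0∞) (a b : Project.{u, v} M p) : ℂ :=
  ∑' k : ℕ, productForm₃ M tr p a.dialect a.form b.dialect b.form (interaction a b ^ (k + 1)) /
    ((k : ℂ) + 1)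

open Classical in
/-- The measurement between the operators of two projects: `ldet(1 - A† B‡)`, which is a real
number, if the spectral radius of `A† B‡` is less than one, and `∞` otherwise. -/
def opMeasure (tr : (H →L[ℂ] H) → ℝ≥0∞) (a b : Project.{u, v} M p) : WithTop ℝ :=
  if spectralRadius ℂ (interaction a b) < 1 then ((ldet tr a b).re : ℝ) else ⊤

/-- The measurement `α(1) b + β(1) a + ⟪A, B⟫` between two projects. -/
def measure (tr : (H →L[ℂ] H) → ℝ≥0∞) (a b : Project.{u, v} M p) : WithTop ℝ :=
  ((a.form 1).re : ℝ) * b.wager + ((b.form 1).re : ℝ) * a.wager + opMeasure tr a b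

/-- Orthogonality of projects: their measurement is neither `0` nor `∞`. -/
def Orthogonal (tr : (H →L[ℂ] H) → ℝ≥0∞) (a b : Project.{u, v} M p) : Prop :=
  measure tr a b ≠ 0 ∧ measure tr a b ≠ ⊤

/-- The orthogonal of a set of projects of carrier `p`. -/
def orth (tr : (H →L[ℂ] H) → ℝ≥0∞) (A : Set (Project.{u, v} M p)) : Set (Project.{u, v} M p) :=
  {b | ∀ a ∈ A, Orthogonal tr a b}

/-- Conducts of carrier `p`: sets of projects of carrier `p` equal to their biorthogonal. -/
def IsConduct (tr : (H →L[ℂ] H) → ℝ≥0∞) (A : Set (Project.{u, v} M p)) : Prop :=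
  A = orth tr (orth tr A)

/-- The project `a` is promising with respect to the outlook `P`. -/
structure IsPromising (tr : (H →L[ℂ] H) → ℝ≥0∞) (P : VonNeumannAlgebra H)
    (a : Project.{u, v} M p) : Prop where
  /-- The dialect is a matrix algebra, and the pseudo-trace is its normalised trace. -/
  dialect_trace : ∃ n : ℕ, n ≠ 0 ∧
    ∃ e : a.dialect.toStarSubalgebra ≃⋆ₐ[ℂ] Matrix (Fin n) (Fin n) ℂ,
      ∀ x, a.form x = (e x).trace / n
  wager_eq : a.wager = 0
  /-- The operator is a partial symmetry in the normalising groupoid of `P ⊗ Q` for a MASA `Q`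
  of the dialect, and `tr(π A) = 0` for each projection `π` of `P ⊗ N(Q)`, where `N(Q)` is
  generated by the normaliser of `Q` in the dialect. -/
  symmetry_traces : ∃ Q : VonNeumannAlgebra a.K, IsMASA Q a.dialect ∧
    IsPartialSymmetry a.op ∧
    a.op ∈ normalisingGroupoid
      (vnTensor (M : Set (H →L[ℂ] H)) (a.dialect : Set (a.K →L[ℂ] a.K)))
      (vnTensor (P : Set (H →L[ℂ] H)) (Q : Set (a.K →L[ℂ] a.K))) ∧
    ∀ π ∈ vnTensor (P : Set (H →L[ℂ] H))
        (normaliserAlgebra (a.dialect : Set (a.K →L[ℂ] a.K)) (Q : Set (a.K →L[ℂ] a.K))),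
      IsStarProjection π → productForm M tr p a.dialect a.form (π * a.op) = 0

end Projects

end MatGoI

end

noncomputable section

namespace MatGoI

open scoped Topology

/-! ### The σ-weak topology -/

section SigmaWeak

variable {H : Type*} [NormedAddCommGroup H] [InnerProductSpace ℂ H]
variable {K : Type*} [NormedAddCommGroup K] [InnerProductSpace ℂ K]

/-! Every element of a conduct is orthogonal to every element of its orthogonal, so it is enough
that two promising projects are never orthogonal (`not_orthogonal_of_isPromising`). Their wagers
vanish, which reduces the measurement to `[A, B]`. This is `∞` unless `u = A†B‡` has spectral radius
less than one, and in that case it turns out to be `0`.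

Let `D = P ⊗ Q ⊗ Q'`, a commutative algebra. Both `A†` and `B‡` are hermitian partial isometries
normalising `D`, so `u` and all its powers are partial isometries normalising `D`
(`IsNormalisingPI.mul`, `IsNormalisingPI.pow`). A nonzero partial isometry has norm one, so by
Gelfand's formula a spectral radius below one forces `u` to be nilpotent
(`exists_pow_eq_zero_of_spectralRadius_lt_one`). A trace vanishes on a nilpotent partial isometry
normalising `D` (`IsNormalisingPI.trace_eq_zero`); applied to each power of `u`, this kills every
term of the series (`ldet_eq_zero`).

The rest is transport through σ-weak closures: products, commutation and traciality are checked on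
simple tensors and extended by separate continuity. The analytic input is the σ-weak continuity of
`x ↦ x ⊗ 1` (`continuous_opTensor_one`). -/

theorem summable_inner_apply {ι : Type*} {ξ : ι → H} {η : ι → K}
    (hξ : Summable fun i => ‖ξ i‖ ^ 2) (hη : Summable fun i => ‖η i‖ ^ 2) (x : K →L[ℂ] H) :
    Summable fun i => inner ℂ (ξ i) (x (η i)) := by
  refine .of_norm_bounded (hξ.add (hη.mul_left (‖x‖ ^ 2))) fun i => ?_
  have h1 := norm_inner_le_norm (𝕜 := ℂ) (ξ i) (x (η i))
  have h2 : ‖x (η i)‖ ^ 2 ≤ (‖x‖ * ‖η i‖) ^ 2 := by gcongr; exact x.le_opNorm _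
  nlinarith [sq_nonneg (‖ξ i‖ - ‖x (η i)‖), sq_nonneg ‖ξ i‖, sq_nonneg ‖x (η i)‖]

theorem continuous_tsum_inner_nat {ξ η : ℕ → H} (hξ : Summable fun i => ‖ξ i‖ ^ 2)
    (hη : Summable fun i => ‖η i‖ ^ 2) :
    Continuous[sigmaWeak H, inferInstance] fun x : H →L[ℂ] H => ∑' i, inner ℂ (ξ i) (x (η i)) :=
  continuous_iInf_dom <| continuous_iInf_dom <| continuous_iInf_dom (i := hξ) <|
    continuous_iInf_dom (i := hη) continuous_induced_dom

/-- Square-summability makes the support of `ξ` countable, so it embeds in `ℕ` and both families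
extend by zero to sequences. The general index type is needed for families over `ℕ × s`, with `s`
indexing a Hilbert basis. -/
theorem continuous_tsum_inner {ι : Type*} {ξ η : ι → H} (hξ : Summable fun i => ‖ξ i‖ ^ 2)
    (hη : Summable fun i => ‖η i‖ ^ 2) :
    Continuous[sigmaWeak H, inferInstance] fun x : H →L[ℂ] H => ∑' i, inner ℂ (ξ i) (x (η i)) := by
  set s : Set ι := Function.support fun i => ‖ξ i‖ ^ 2 with hs
  have : Countable s := hξ.countable_support.to_subtype
  obtain ⟨e, he⟩ := exists_injective_nat s
  have aux : ∀ ζ : s → H, (Summable fun i => ‖ζ i‖ ^ 2) →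
      Summable fun n => ‖Function.extend e ζ 0 n‖ ^ 2 := fun ζ hζ => by
    have : (fun n => ‖Function.extend e ζ 0 n‖ ^ 2) = Function.extend e (fun i => ‖ζ i‖ ^ 2) 0 := by
      funext n
      by_cases hn : ∃ i, e i = n
      · obtain ⟨i, rfl⟩ := hn
        rw [he.extend_apply, he.extend_apply]
      · rw [Function.extend_apply' _ _ _ hn, Function.extend_apply' _ _ _ hn]
        simp
    rw [this]
    exact (summable_extend_zero he).2 hζ
  convert continuous_tsum_inner_nat (aux (fun i => ξ i) (hξ.subtype s))
    (aux (fun i => η i) (hη.subtype s)) using 2 with x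
  have h1 : (fun n => inner ℂ (Function.extend e (fun i : s => ξ i) 0 n)
      (x (Function.extend e (fun i : s => η i) 0 n))) =
      Function.extend e (fun i : s => inner ℂ (ξ i) (x (η i))) 0 := by
    funext n
    by_cases hn : ∃ i, e i = n
    · obtain ⟨i, rfl⟩ := hn
      rw [he.extend_apply, he.extend_apply, he.extend_apply]
    · rw [Function.extend_apply' _ _ _ hn, Function.extend_apply' _ _ _ hn,
        Function.extend_apply' _ _ _ hn]
      simp
  rw [h1, tsum_extend_zero he]
  refine (tsum_subtype_eq_of_support_subset (s := s)
    (f := fun i => inner ℂ (ξ i) (x (η i))) fun i hi => ?_).symm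
  intro h0
  refine hi ?_
  have : ξ i = 0 := by simpa using h0
  simp [this]

theorem continuous_sigmaWeak_rng {X : Type*} {t : TopologicalSpace X} {F : X → (H →L[ℂ] H)}
    (h : ∀ ξ η : ℕ → H, (Summable fun n => ‖ξ n‖ ^ 2) → (Summable fun n => ‖η n‖ ^ 2) →
      Continuous fun x => ∑' n, inner ℂ (ξ n) (F x (η n))) :
    Continuous[t, sigmaWeak H] F :=
  continuous_iInf_rng.2 fun ξ => continuous_iInf_rng.2 fun η => continuous_iInf_rng.2 fun hξ =>
    continuous_iInf_rng.2 fun hη => continuous_induced_rng.2 (h ξ η hξ hη)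

theorem continuous_inner_apply (ξ η : H) :
    Continuous[sigmaWeak H, inferInstance] fun x : H →L[ℂ] H => inner ℂ ξ (x η) := by
  have h := continuous_tsum_inner (ι := Unit) (ξ := fun _ => ξ) (η := fun _ => η)
    (hasSum_fintype _).summable (hasSum_fintype _).summable
  simpa using h

theorem summable_norm_sq_apply {ι : Type*} {ξ : ι → H} (hξ : Summable fun i => ‖ξ i‖ ^ 2)
    (a : H →L[ℂ] K) : Summable fun i => ‖a (ξ i)‖ ^ 2 := by
  refine .of_nonneg_of_le (fun i => by positivity) (fun i => ?_) (hξ.mul_left (‖a‖ ^ 2))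
  rw [← mul_pow]
  gcongr
  exact a.le_opNorm _

/-- In `⟪ξₙ, a x b ηₙ⟫` the operator `a` moves to `ξₙ` as its adjoint and `b` acts on `ηₙ`; both new
families remain square-summable. -/
theorem continuous_comp_comp [CompleteSpace H] [CompleteSpace K] (a : H →L[ℂ] K) (b : K →L[ℂ] H) :
    Continuous[sigmaWeak H, sigmaWeak K] fun x : H →L[ℂ] H => a ∘L (x ∘L b) := by
  refine @continuous_sigmaWeak_rng _ _ _ _ (sigmaWeak H) _ fun ξ η hξ hη => ?_
  convert continuous_tsum_inner (summable_norm_sq_apply hξ (ContinuousLinearMap.adjoint a))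
    (summable_norm_sq_apply hη b) using 4 with x n
  simp [ContinuousLinearMap.adjoint_inner_left]

theorem continuous_mul_mul [CompleteSpace H] (a b : H →L[ℂ] H) :
    Continuous[sigmaWeak H, sigmaWeak H] fun x : H →L[ℂ] H => a * x * b :=
  continuous_comp_comp a b

theorem continuous_const_mul_sigmaWeak [CompleteSpace H] (a : H →L[ℂ] H) :
    Continuous[sigmaWeak H, sigmaWeak H] fun x : H →L[ℂ] H => a * x := by
  simpa using continuous_mul_mul a 1

theorem continuous_mul_const_sigmaWeak [CompleteSpace H] (a : H →L[ℂ] H) :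
    Continuous[sigmaWeak H, sigmaWeak H] fun x : H →L[ℂ] H => x * a := by
  simpa using continuous_mul_mul 1 a

theorem continuous_const_add_sigmaWeak (a : H →L[ℂ] H) :
    Continuous[sigmaWeak H, sigmaWeak H] fun x : H →L[ℂ] H => a + x := by
  refine @continuous_sigmaWeak_rng _ _ _ _ (sigmaWeak H) _ fun ξ η hξ hη => ?_
  have h := @Continuous.comp _ _ _ (sigmaWeak H) _ _ _ _
    (continuous_const_add (∑' n, inner ℂ (ξ n) (a (η n)))) (continuous_tsum_inner hξ hη)
  convert h using 2 with x
  rw [Function.comp_apply, ← (summable_inner_apply hξ hη a).tsum_add (summable_inner_apply hξ hη x)]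
  simp

theorem continuous_const_smul_sigmaWeak (c : ℂ) :
    Continuous[sigmaWeak H, sigmaWeak H] fun x : H →L[ℂ] H => c • x := by
  refine @continuous_sigmaWeak_rng _ _ _ _ (sigmaWeak H) _ fun ξ η hξ hη => ?_
  have h := @Continuous.comp _ _ _ (sigmaWeak H) _ _ _ _ (continuous_const_mul c)
    (continuous_tsum_inner hξ hη)
  convert h using 2 with x
  rw [Function.comp_apply, ← tsum_mul_left]
  simp

/-! ### σ-weakly closed spans -/

/-- The σ-weakly closed linear span. -/
def swSpan (S : Set (H →L[ℂ] H)) : Set (H →L[ℂ] H) :=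
  @closure _ (sigmaWeak H) (Submodule.span ℂ S : Set (H →L[ℂ] H))

theorem span_subset_swSpan (S : Set (H →L[ℂ] H)) :
    (Submodule.span ℂ S : Set (H →L[ℂ] H)) ⊆ swSpan S :=
  @subset_closure _ (sigmaWeak H) _

theorem subset_swSpan (S : Set (H →L[ℂ] H)) : S ⊆ swSpan S :=
  Submodule.subset_span.trans (span_subset_swSpan S)

theorem isClosed_swSpan (S : Set (H →L[ℂ] H)) : IsClosed[sigmaWeak H] (swSpan S) :=
  @isClosed_closure _ (sigmaWeak H) _

theorem swSpan_subset_of_isClosed {S C : Set (H →L[ℂ] H)} (hC : IsClosed[sigmaWeak H] C)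
    (h : (Submodule.span ℂ S : Set (H →L[ℂ] H)) ⊆ C) : swSpan S ⊆ C :=
  @closure_minimal _ (sigmaWeak H) _ _ h hC

theorem smul_mem_swSpan {S : Set (H →L[ℂ] H)} (c : ℂ) {x : H →L[ℂ] H} (hx : x ∈ swSpan S) :
    c • x ∈ swSpan S :=
  swSpan_subset_of_isClosed
    (@IsClosed.preimage _ _ (sigmaWeak H) (sigmaWeak H) _ (continuous_const_smul_sigmaWeak c) _
      (isClosed_swSpan S))
    (fun _ hy => span_subset_swSpan S (Submodule.smul_mem _ c hy)) hx

theorem add_mem_swSpan {S : Set (H →L[ℂ] H)} {x y : H →L[ℂ] H} (hx : x ∈ swSpan S)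
    (hy : y ∈ swSpan S) : x + y ∈ swSpan S := by
  -- Only continuity of translations is used, so the closure is taken in one summand at a time:
  -- `key` serves first with `z` in the span, then with `z = x`.
  have key : ∀ z : H →L[ℂ] H, (∀ t ∈ Submodule.span ℂ S, z + t ∈ swSpan S) →
      ∀ t ∈ swSpan S, z + t ∈ swSpan S := fun z hz =>
    swSpan_subset_of_isClosed (@IsClosed.preimage _ _ (sigmaWeak H) (sigmaWeak H) _
      (continuous_const_add_sigmaWeak z) _ (isClosed_swSpan S)) hz
  refine key x (fun t ht => ?_) y hy
  rw [add_comm]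
  exact key t (fun s hs => span_subset_swSpan S (add_mem ht hs)) x hx

theorem swSpan_map {S : Set (H →L[ℂ] H)} {T : Set (K →L[ℂ] K)}
    {F : (H →L[ℂ] H) →ₗ[ℂ] (K →L[ℂ] K)} (hF : Continuous[sigmaWeak H, sigmaWeak K] F)
    (h : ∀ x ∈ S, F x ∈ swSpan T) {x : H →L[ℂ] H} (hx : x ∈ swSpan S) : F x ∈ swSpan T := by
  refine swSpan_subset_of_isClosed (@IsClosed.preimage _ _ (sigmaWeak H) (sigmaWeak K) _ hF _
    (isClosed_swSpan T)) (fun y hy => ?_) hx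
  induction hy using Submodule.span_induction with
  | mem y hy => exact h y hy
  | zero => exact span_subset_swSpan T (by simp)
  | add y z _ _ hy hz =>
    rw [Set.mem_preimage, map_add]
    exact add_mem_swSpan hy hz
  | smul c y _ hy =>
    rw [Set.mem_preimage, map_smul]
    exact smul_mem_swSpan c hy

theorem swSpan_eqOn {S : Set (H →L[ℂ] H)} {f g : (H →L[ℂ] H) →ₗ[ℂ] ℂ}
    (hf : Continuous[sigmaWeak H, inferInstance] f) (hg : Continuous[sigmaWeak H, inferInstance] g)
    (h : ∀ x ∈ S, f x = g x) {x : H →L[ℂ] H} (hx : x ∈ swSpan S) : f x = g x :=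
  swSpan_subset_of_isClosed (C := {y | f y = g y}) (@isClosed_eq _ _ _ (sigmaWeak H) _ _ _ hf hg)
    (fun _ hy => LinearMap.eqOn_span (fun _ hz => h _ hz) hy) hx

/-- Separate σ-weak continuity of multiplication suffices: the left factor is passed to the closure
with the right one fixed in `S`, then the right factor. -/
theorem mul_mem_swSpan [CompleteSpace H] {S : Set (H →L[ℂ] H)}
    (hS : ∀ x ∈ S, ∀ y ∈ S, x * y ∈ swSpan S) {x y : H →L[ℂ] H} (hx : x ∈ swSpan S)
    (hy : y ∈ swSpan S) : x * y ∈ swSpan S :=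
  swSpan_map (F := LinearMap.mulLeft ℂ x) (continuous_const_mul_sigmaWeak x)
    (fun y hy => swSpan_map (F := LinearMap.mulRight ℂ y) (continuous_mul_const_sigmaWeak y)
      (fun z hz => hS z hz y hy) hx) hy

theorem trace_comm_swSpan [CompleteSpace H] {S : Set (H →L[ℂ] H)} {φ : (H →L[ℂ] H) →ₗ[ℂ] ℂ}
    (hφ : Continuous[sigmaWeak H, inferInstance] φ)
    (hS : ∀ x ∈ S, ∀ y ∈ S, φ (x * y) = φ (y * x)) {x y : H →L[ℂ] H} (hx : x ∈ swSpan S)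
    (hy : y ∈ swSpan S) : φ (x * y) = φ (y * x) := by
  have hl : ∀ z, Continuous[sigmaWeak H, inferInstance] (φ ∘ₗ LinearMap.mulLeft ℂ z) := fun z =>
    @Continuous.comp _ _ _ (sigmaWeak H) (sigmaWeak H) _ _ φ hφ (continuous_const_mul_sigmaWeak z)
  have hr : ∀ z, Continuous[sigmaWeak H, inferInstance] (φ ∘ₗ LinearMap.mulRight ℂ z) := fun z =>
    @Continuous.comp _ _ _ (sigmaWeak H) (sigmaWeak H) _ _ φ hφ (continuous_mul_const_sigmaWeak z)
  exact swSpan_eqOn (hl x) (hr x)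
    (fun y hy => swSpan_eqOn (hr y) (hl y) (fun z hz => hS z hz y hy) hx) hy

/-- The vector forms `z ↦ ⟪ξ, z η⟫` are σ-weakly continuous and separate operators, so commutation
follows from `trace_comm_swSpan` applied to each of them. -/
theorem commute_swSpan [CompleteSpace H] {S : Set (H →L[ℂ] H)}
    (hS : ∀ x ∈ S, ∀ y ∈ S, x * y = y * x) {x y : H →L[ℂ] H} (hx : x ∈ swSpan S)
    (hy : y ∈ swSpan S) : x * y = y * x := by
  refine ContinuousLinearMap.ext fun η => ext_inner_left ℂ fun ξ => ?_
  let φ : (H →L[ℂ] H) →ₗ[ℂ] ℂ :=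
    { toFun := fun z => inner ℂ ξ (z η)
      map_add' := fun a b => by simp
      map_smul' := fun c a => by simp }
  exact trace_comm_swSpan (φ := φ) (continuous_inner_apply ξ η)
    (fun x hx y hy => by rw [hS x hx y hy]) hx hy

end SigmaWeak

/-! ### Operators on Hilbert tensor products -/

section Tensor

variable {H : Type*} [NormedAddCommGroup H] [InnerProductSpace ℂ H]
variable {K : Type*} [NormedAddCommGroup K] [InnerProductSpace ℂ K]
variable {L : Type*} [NormedAddCommGroup L] [InnerProductSpace ℂ L]

theorem opTensor_add_left (x y : H →L[ℂ] H) (a : K →L[ℂ] K) :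
    opTensor (x + y) a = opTensor x a + opTensor y a :=
  htensor_ext fun h k => by simp [opTensor_tmulH, tmulH_add_left]

theorem opTensor_smul_left (c : ℂ) (x : H →L[ℂ] H) (a : K →L[ℂ] K) :
    opTensor (c • x) a = c • opTensor x a :=
  htensor_ext fun h k => by simp [opTensor_tmulH, tmulH_smul_left]

theorem opTensor_mul (x y : H →L[ℂ] H) (a b : K →L[ℂ] K) :
    opTensor x a * opTensor y b = opTensor (x * y) (a * b) :=
  htensor_ext fun h k => by simp [opTensor_tmulH]

theorem opTensor_one : opTensor (1 : H →L[ℂ] H) (1 : K →L[ℂ] K) = 1 :=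
  htensor_ext fun h k => by simp [opTensor_tmulH]

/-- `x ↦ x ⊗ a` as a linear map. -/
def opTensorLeft (H : Type*) [NormedAddCommGroup H] [InnerProductSpace ℂ H] (a : K →L[ℂ] K) :
    (H →L[ℂ] H) →ₗ[ℂ] (HTensor H K →L[ℂ] HTensor H K) where
  toFun x := opTensor x a
  map_add' x y := opTensor_add_left x y a
  map_smul' c x := opTensor_smul_left c x a

theorem star_opTensor [CompleteSpace H] [CompleteSpace K] (x : H →L[ℂ] H) (a : K →L[ℂ] K) :
    star (opTensor x a) = opTensor (star x) (star a) := by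
  refine htensor_ext fun h k => ext_inner_right ℂ fun t => ?_
  rw [ContinuousLinearMap.star_eq_adjoint, ContinuousLinearMap.adjoint_inner_left]
  induction t using htensor_induction with
  | hc => exact isClosed_eq (by fun_prop) (by fun_prop)
  | h0 => simp
  | ht h' k' =>
    rw [opTensor_tmulH, opTensor_tmulH, inner_tmulH, inner_tmulH,
      ContinuousLinearMap.star_eq_adjoint, ContinuousLinearMap.star_eq_adjoint,
      ContinuousLinearMap.adjoint_inner_left, ContinuousLinearMap.adjoint_inner_left]
  | ha s t hs ht => simp only [map_add, inner_add_right, hs, ht]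

theorem htensor_ext₃ {E : Type*} [NormedAddCommGroup E] [NormedSpace ℂ E]
    {f g : HTensor (HTensor H K) L →L[ℂ] E}
    (h : ∀ x y z, f (tmulH (tmulH x y) z) = g (tmulH (tmulH x y) z)) : f = g := by
  refine htensor_ext fun t z => ?_
  have : f ∘L rightLeg (HTensor H K) z = g ∘L rightLeg (HTensor H K) z :=
    htensor_ext fun x y => h x y z
  exact DFunLike.congr_fun this t

theorem swapU_comp_swapU : swapU H L K ∘L swapU H K L = 1 :=
  htensor_ext₃ fun x y z => by simp [swapU_tmulH]

theorem swapU_comp_opTensor_comp_swapU (x : H →L[ℂ] H) (a : K →L[ℂ] K) (b : L →L[ℂ] L) :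
    swapU H L K ∘L (opTensor (opTensor x b) a ∘L swapU H K L) = opTensor (opTensor x a) b :=
  htensor_ext₃ fun x y z => by simp [swapU_tmulH, opTensor_tmulH]

theorem adjoint_swapU [CompleteSpace H] [CompleteSpace K] [CompleteSpace L] :
    ContinuousLinearMap.adjoint (swapU H K L) = swapU H L K := by
  refine htensor_ext₃ fun x z y => ext_inner_right ℂ fun t => ?_
  rw [ContinuousLinearMap.adjoint_inner_left]
  have : innerSL ℂ (tmulH (tmulH x z) y) ∘L swapU H K L =
      innerSL ℂ (swapU H L K (tmulH (tmulH x z) y)) :=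
    htensor_ext₃ fun x' y' z' => by
      simp only [ContinuousLinearMap.comp_apply, innerSL_apply_apply, swapU_tmulH, inner_tmulH]
      ring
  exact DFunLike.congr_fun this t

/-! ### Slices along a Hilbert basis and continuity of amplification -/

/-- The operator `k ↦ h ⊗ k`. -/
def leftLeg (K : Type*) [NormedAddCommGroup K] [InnerProductSpace ℂ K] (h : H) :
    K →L[ℂ] HTensor H K :=
  toH H K ∘L TensorProduct.mkL ℂ H K h

theorem rightLeg_apply (h : H) (k : K) : rightLeg H k h = tmulH h k := rfl

/-- The isometries `h ↦ h ⊗ b j` have orthogonal ranges with dense sum, so `H ⊗ K` is a Hilbert sum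
of copies of `H`. The `j`-th coordinate of `ξ` is its image under the adjoint of the `j`-th
isometry. -/
theorem hasSum_slices [CompleteSpace H] {ι : Type*} (b : HilbertBasis ι ℂ K) (ξ : HTensor H K) :
    HasSum (fun j => rightLeg H (b j) (ContinuousLinearMap.adjoint (rightLeg H (b j)) ξ)) ξ := by
  classical
  let V : ι → H →ₗᵢ[ℂ] HTensor H K := fun j =>
    { toLinearMap := (rightLeg H (b j)).toLinearMap
      norm_map' := fun h => by
        have h1 : inner ℂ (tmulH h (b j)) (tmulH h (b j)) = inner ℂ h h := by
          rw [inner_tmulH, inner_self_eq_norm_sq_to_K (b j), b.orthonormal.1 j]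
          simp
        change ‖tmulH h (b j)‖ = ‖h‖
        rw [@norm_eq_sqrt_re_inner ℂ, h1, ← @norm_eq_sqrt_re_inner ℂ] }
  have hVa : ∀ j h, V j h = tmulH h (b j) := fun _ _ => rfl
  have hV : IsHilbertSum ℂ (fun _ : ι => H) V := by
    refine IsHilbertSum.mk (fun i j hij x y => ?_) fun t ht => ?_
    · rw [hVa, hVa, inner_tmulH, b.orthonormal.2 hij, mul_zero]
    · set C := (⨆ i, LinearMap.range (V i).toLinearMap).topologicalClosure with hC
      have hCc : IsClosed (C : Set (HTensor H K)) := Submodule.isClosed_topologicalClosure _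
      clear ht
      induction t using htensor_induction with
      | hc => exact hCc
      | h0 => exact zero_mem C
      | ha s t hs ht => exact add_mem hs ht
      | ht h k =>
        -- For fixed `h`, the vectors `k` with `h ⊗ k ∈ C` form a closed subspace containing the
        -- basis, hence all of `K`.
        have h1 : Submodule.span ℂ (Set.range b) ≤ C.comap (leftLeg K h).toLinearMap := by
          rw [Submodule.span_le]
          rintro _ ⟨i, rfl⟩
          exact Submodule.le_topologicalClosure _ (Submodule.mem_iSup_of_mem i ⟨h, rfl⟩)
        have h2 := Submodule.topologicalClosure_minimal _ h1
          (hCc.preimage (leftLeg K h).continuous)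
        rw [b.dense_span] at h2
        exact h2 (Submodule.mem_top (x := k))
  have h1 := hV.hasSum_linearIsometryEquiv_symm (hV.linearIsometryEquiv ξ)
  rw [LinearIsometryEquiv.symm_apply_apply] at h1
  convert h1 using 2 with j
  change V j _ = V j _
  congr 1
  refine ext_inner_left ℂ fun h => ?_
  rw [ContinuousLinearMap.adjoint_inner_right]
  change inner ℂ (V j h) ξ = _
  rw [← hV.linearIsometryEquiv_symm_apply_single, LinearIsometryEquiv.inner_map_eq_flip,
    LinearIsometryEquiv.symm_symm, lp.inner_single_left]

theorem hasSum_norm_sq_slices [CompleteSpace H] {ι : Type*} (b : HilbertBasis ι ℂ K)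
    (ξ : HTensor H K) :
    HasSum (fun j => ‖ContinuousLinearMap.adjoint (rightLeg H (b j)) ξ‖ ^ 2) (‖ξ‖ ^ 2) := by
  have h := ((hasSum_slices b ξ).mapL (innerSL ℂ ξ)).mapL Complex.reCLM
  simp only [← inner_self_eq_norm_sq (𝕜 := ℂ), ContinuousLinearMap.adjoint_inner_left]
  exact h

theorem adjoint_rightLeg_opTensor_one [CompleteSpace H] (x : H →L[ℂ] H) (k : K)
    (η : HTensor H K) : ContinuousLinearMap.adjoint (rightLeg H k) (opTensor x 1 η) =
      x (ContinuousLinearMap.adjoint (rightLeg H k) η) := by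
  have hr : ∀ h l, ContinuousLinearMap.adjoint (rightLeg H k) (tmulH h l) = inner ℂ k l • h :=
    fun h l => ext_inner_left ℂ fun h' => by
      rw [ContinuousLinearMap.adjoint_inner_right, rightLeg_apply, inner_tmulH, inner_smul_right,
        mul_comm]
  have : ContinuousLinearMap.adjoint (rightLeg H k) ∘L opTensor x 1 =
      x ∘L ContinuousLinearMap.adjoint (rightLeg H k) :=
    htensor_ext fun h l => by simp [opTensor_tmulH, hr]
  exact DFunLike.congr_fun this η

theorem hasSum_inner_opTensor_one [CompleteSpace H] {ι : Type*} (b : HilbertBasis ι ℂ K)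
    (x : H →L[ℂ] H) (ξ η : HTensor H K) :
    HasSum (fun j => inner ℂ (ContinuousLinearMap.adjoint (rightLeg H (b j)) ξ)
      (x (ContinuousLinearMap.adjoint (rightLeg H (b j)) η))) (inner ℂ ξ (opTensor x 1 η)) := by
  have h := (hasSum_slices b (opTensor x 1 η)).mapL (innerSL ℂ ξ)
  simpa only [innerSL_apply_apply, ← ContinuousLinearMap.adjoint_inner_left,
    adjoint_rightLeg_opTensor_one] using h

/-- Slicing commutes with `x ⊗ 1`, so cutting each `ξₙ` and `ηₙ` along a basis of `K` turns a σ-weak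
form on `B(H ⊗ K)` into one on `B(H)`, indexed by pairs. Parseval's identity keeps the sliced
families square-summable. -/
theorem continuous_opTensor_one [CompleteSpace H] [CompleteSpace K] :
    Continuous[sigmaWeak H, sigmaWeak (HTensor H K)]
      fun x : H →L[ℂ] H => opTensor x (1 : K →L[ℂ] K) := by
  obtain ⟨s, b, -⟩ := exists_hilbertBasis ℂ K
  refine @continuous_sigmaWeak_rng _ _ _ _ (sigmaWeak H) _ fun ξ η hξ hη => ?_
  have hs : ∀ ζ : ℕ → HTensor H K, (Summable fun n => ‖ζ n‖ ^ 2) → Summable fun q : ℕ × s =>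
      ‖ContinuousLinearMap.adjoint (rightLeg H (b q.2)) (ζ q.1)‖ ^ 2 := fun ζ hζ =>
    (summable_prod_of_nonneg fun q => by positivity).2
      ⟨fun n => (hasSum_norm_sq_slices b (ζ n)).summable, by
        simpa only [(hasSum_norm_sq_slices b (ζ _)).tsum_eq] using hζ⟩
  convert continuous_tsum_inner (hs ξ hξ) (hs η hη) using 2 with x
  rw [(summable_inner_apply (hs ξ hξ) (hs η hη) x).tsum_prod]
  exact tsum_congr fun n => (hasSum_inner_opTensor_one b x (ξ n) (η n)).tsum_eq.symm

theorem continuous_opTensorLeft [CompleteSpace H] [CompleteSpace K] (a : K →L[ℂ] K) :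
    Continuous[sigmaWeak H, sigmaWeak (HTensor H K)] (opTensorLeft H a) := by
  have h := @Continuous.comp _ _ _ (sigmaWeak H) (sigmaWeak (HTensor H K))
    (sigmaWeak (HTensor H K)) _ _ (continuous_mul_const_sigmaWeak (opTensor 1 a))
    continuous_opTensor_one
  have e : ⇑(opTensorLeft H a) =
      (fun x => x * opTensor 1 a) ∘ fun x : H →L[ℂ] H => opTensor x (1 : K →L[ℂ] K) := by
    funext x
    rw [Function.comp_apply, opTensor_mul, mul_one, one_mul]
    rfl
  rwa [e]

/-! ### Triple tensor products -/

/-- The simple tensors `x ⊗ a ⊗ b`. -/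
def simpleTensors₃ (S : Set (H →L[ℂ] H)) (T : Set (K →L[ℂ] K)) (U : Set (L →L[ℂ] L)) :
    Set (HTensor (HTensor H K) L →L[ℂ] HTensor (HTensor H K) L) :=
  {z | ∃ x ∈ S, ∃ a ∈ T, ∃ b ∈ U, z = opTensor (opTensor x a) b}

/-- The von Neumann tensor product of three sets of operators. -/
def vnTensor₃ (S : Set (H →L[ℂ] H)) (T : Set (K →L[ℂ] K)) (U : Set (L →L[ℂ] L)) :
    Set (HTensor (HTensor H K) L →L[ℂ] HTensor (HTensor H K) L) :=
  swSpan (simpleTensors₃ S T U)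

variable {S : Set (H →L[ℂ] H)} {T : Set (K →L[ℂ] K)} {U : Set (L →L[ℂ] L)}

theorem opTensor_mem_vnTensor₃ [CompleteSpace L] {A : HTensor H K →L[ℂ] HTensor H K} (hA : A ∈ vnTensor S T)
    {b : L →L[ℂ] L} (hb : b ∈ U) : opTensor A b ∈ vnTensor₃ S T U := by
  refine swSpan_map (F := opTensorLeft _ b) (continuous_opTensorLeft b) ?_ hA
  rintro _ ⟨x, hx, a, ha, rfl⟩
  exact subset_swSpan _ ⟨x, hx, a, ha, b, hb, rfl⟩

/-- Conjugation by the exchange of the last two factors. -/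
def swapConj (H : Type*) [NormedAddCommGroup H] [InnerProductSpace ℂ H]
    (K : Type*) [NormedAddCommGroup K] [InnerProductSpace ℂ K]
    (L : Type*) [NormedAddCommGroup L] [InnerProductSpace ℂ L] :
    (HTensor (HTensor H L) K →L[ℂ] HTensor (HTensor H L) K) →ₗ[ℂ]
      (HTensor (HTensor H K) L →L[ℂ] HTensor (HTensor H K) L) where
  toFun z := swapU H L K ∘L (z ∘L swapU H K L)
  map_add' x y := by ext; simp
  map_smul' c x := by ext; simp

theorem swapConj_opTensor (x : H →L[ℂ] H) (a : K →L[ℂ] K) (b : L →L[ℂ] L) :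
    swapConj H K L (opTensor (opTensor x b) a) = opTensor (opTensor x a) b :=
  swapU_comp_opTensor_comp_swapU x a b

theorem swapConj_mul (y z : HTensor (HTensor H L) K →L[ℂ] HTensor (HTensor H L) K) :
    swapConj H K L y * swapConj H K L z = swapConj H K L (y * z) := by
  ext t
  have h : ∀ s, swapU H K L (swapU H L K s) = s := fun s =>
    DFunLike.congr_fun (swapU_comp_swapU (H := H) (K := L) (L := K)) s
  simp [swapConj, h]

theorem star_swapConj [CompleteSpace H] [CompleteSpace K] [CompleteSpace L]
    (z : HTensor (HTensor H L) K →L[ℂ] HTensor (HTensor H L) K) :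
    star (swapConj H K L z) = swapConj H K L (star z) := by
  simp only [swapConj, LinearMap.coe_mk, AddHom.coe_mk, ContinuousLinearMap.star_eq_adjoint,
    ContinuousLinearMap.adjoint_comp, adjoint_swapU]
  rfl

theorem swapConj_opTensor_mem_vnTensor₃ [CompleteSpace K] {B : HTensor H L →L[ℂ] HTensor H L}
    (hB : B ∈ vnTensor S U) {a : K →L[ℂ] K} (ha : a ∈ T) :
    swapConj H K L (opTensor B a) ∈ vnTensor₃ S T U := by
  refine swSpan_map (F := swapConj H K L ∘ₗ opTensorLeft _ a)
    (@Continuous.comp _ _ _ (sigmaWeak _) (sigmaWeak _) (sigmaWeak _) _ (swapConj H K L)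
      (continuous_comp_comp _ _) (continuous_opTensorLeft a)) ?_ hB
  rintro _ ⟨x, hx, b, hb, rfl⟩
  exact subset_swSpan _ ⟨x, hx, a, ha, b, hb, swapConj_opTensor x a b⟩

theorem mul_mem_vnTensor₃ (hS : ∀ x ∈ S, ∀ y ∈ S, x * y ∈ S) (hT : ∀ x ∈ T, ∀ y ∈ T, x * y ∈ T)
    (hU : ∀ x ∈ U, ∀ y ∈ U, x * y ∈ U)
    {y z : HTensor (HTensor H K) L →L[ℂ] HTensor (HTensor H K) L}
    (hy : y ∈ vnTensor₃ S T U) (hz : z ∈ vnTensor₃ S T U) : y * z ∈ vnTensor₃ S T U := by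
  refine mul_mem_swSpan ?_ hy hz
  rintro _ ⟨x, hx, a, ha, b, hb, rfl⟩ _ ⟨x', hx', a', ha', b', hb', rfl⟩
  rw [opTensor_mul, opTensor_mul]
  exact subset_swSpan _ ⟨_, hS x hx x' hx', _, hT a ha a' ha', _, hU b hb b' hb', rfl⟩

theorem commute_vnTensor₃ (hS : ∀ x ∈ S, ∀ y ∈ S, x * y = y * x)
    (hT : ∀ x ∈ T, ∀ y ∈ T, x * y = y * x) (hU : ∀ x ∈ U, ∀ y ∈ U, x * y = y * x)
    {y z : HTensor (HTensor H K) L →L[ℂ] HTensor (HTensor H K) L}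
    (hy : y ∈ vnTensor₃ S T U) (hz : z ∈ vnTensor₃ S T U) : y * z = z * y := by
  refine commute_swSpan ?_ hy hz
  rintro _ ⟨x, hx, a, ha, b, hb, rfl⟩ _ ⟨x', hx', a', ha', b', hb', rfl⟩
  rw [opTensor_mul, opTensor_mul, opTensor_mul, opTensor_mul, hS x hx x' hx', hT a ha a' ha',
    hU b hb b' hb']

/-- Conjugating `x ⊗ a ⊗ b` by `A ⊗ 1` gives `(A (x ⊗ a) A) ⊗ b`. The bracket need not be a simple
tensor, only an element of `vnTensor S T`. -/
theorem dagger_mul_mul_dagger_mem [CompleteSpace L] {A : HTensor H K →L[ℂ] HTensor H K}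
    (hA : ∀ d ∈ vnTensor S T, A * d * A ∈ vnTensor S T)
    {z : HTensor (HTensor H K) L →L[ℂ] HTensor (HTensor H K) L} (hz : z ∈ vnTensor₃ S T U) :
    dagger L A * z * dagger L A ∈ vnTensor₃ S T U := by
  refine swSpan_map (F := LinearMap.mulLeftRight ℂ (dagger L A, dagger L A))
    (continuous_mul_mul _ _) ?_ hz
  rintro _ ⟨x, hx, a, ha, b, hb, rfl⟩
  rw [LinearMap.mulLeftRight_apply, dagger, opTensor_mul, opTensor_mul, one_mul, mul_one]
  exact opTensor_mem_vnTensor₃ (hA _ (subset_swSpan _ ⟨x, hx, a, ha, rfl⟩)) hb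

theorem ddagger_eq_swapConj (B : HTensor H L →L[ℂ] HTensor H L) :
    ddagger K B = swapConj H K L (opTensor B 1) := rfl

theorem ddagger_mul_mul_ddagger_mem [CompleteSpace K] {B : HTensor H L →L[ℂ] HTensor H L}
    (hB : ∀ d ∈ vnTensor S U, B * d * B ∈ vnTensor S U)
    {z : HTensor (HTensor H K) L →L[ℂ] HTensor (HTensor H K) L} (hz : z ∈ vnTensor₃ S T U) :
    ddagger K B * z * ddagger K B ∈ vnTensor₃ S T U := by
  refine swSpan_map (F := LinearMap.mulLeftRight ℂ (ddagger K B, ddagger K B))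
    (continuous_mul_mul _ _) ?_ hz
  rintro _ ⟨x, hx, a, ha, b, hb, rfl⟩
  rw [LinearMap.mulLeftRight_apply, ddagger_eq_swapConj, ← swapConj_opTensor, swapConj_mul,
    swapConj_mul, opTensor_mul, opTensor_mul, one_mul, mul_one]
  exact swapConj_opTensor_mem_vnTensor₃ (hB _ (subset_swSpan _ ⟨x, hx, b, hb, rfl⟩)) ha

end Tensor

/-! ### Partial isometries normalising a commutative set -/

section Normalising

variable {R : Type*} [Ring R] [StarRing R]

/-- `u` is a partial isometry such that `u D u* ⊆ D` and `u* D u ⊆ D`. -/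
structure IsNormalisingPI (D : Set R) (u : R) : Prop where
  mul_star_mul : u * star u * u = u
  conj_mem : ∀ d ∈ D, u * d * star u ∈ D
  star_conj_mem : ∀ d ∈ D, star u * d * u ∈ D

variable {D : Set R} {u v : R}

theorem IsNormalisingPI.mul_star_mem (hu : IsNormalisingPI D u) (h1 : 1 ∈ D) : u * star u ∈ D := by
  simpa using hu.conj_mem 1 h1

theorem IsNormalisingPI.star_mul_mem (hu : IsNormalisingPI D u) (h1 : 1 ∈ D) : star u * u ∈ D := by
  simpa using hu.star_conj_mem 1 h1

theorem IsNormalisingPI.one : IsNormalisingPI D 1 := ⟨by simp, by simp, by simp⟩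

/-- A product of partial isometries need not be one. Here `u*u` and `vv*` both lie in the
commutative set `D`, so they commute, which is what is required. -/
theorem IsNormalisingPI.mul (hD : ∀ x ∈ D, ∀ y ∈ D, x * y = y * x) (h1 : 1 ∈ D)
    (hu : IsNormalisingPI D u) (hv : IsNormalisingPI D v) : IsNormalisingPI D (u * v) where
  mul_star_mul := by
    calc u * v * star (u * v) * (u * v) = u * ((v * star v) * (star u * u)) * v := by
          rw [star_mul]; noncomm_ring
      _ = (u * star u * u) * (v * star v * v) := by
          rw [hD _ (hv.mul_star_mem h1) _ (hu.star_mul_mem h1)]; noncomm_ring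
      _ = u * v := by rw [hu.mul_star_mul, hv.mul_star_mul]
  conj_mem d hd := by
    have := hu.conj_mem _ (hv.conj_mem d hd)
    simpa only [star_mul, mul_assoc] using this
  star_conj_mem d hd := by
    have := hv.star_conj_mem _ (hu.star_conj_mem d hd)
    simpa only [star_mul, mul_assoc] using this

theorem IsNormalisingPI.pow (hD : ∀ x ∈ D, ∀ y ∈ D, x * y = y * x) (h1 : 1 ∈ D)
    (hu : IsNormalisingPI D u) (n : ℕ) : IsNormalisingPI D (u ^ n) := by
  induction n with
  | zero => simpa using IsNormalisingPI.one
  | succ n ih => rw [pow_succ]; exact ih.mul hD h1 hu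

theorem IsNormalisingPI.of_isSelfAdjoint (hs : star u = u) (hu : u * star u * u = u)
    (h : ∀ d ∈ D, u * d * u ∈ D) : IsNormalisingPI D u :=
  ⟨hu, fun d hd => by rw [hs]; exact h d hd, fun d hd => by rw [hs]; exact h d hd⟩

/-- A form that is tracial on a multiplicatively closed set `C` vanishes on the nilpotent
partial isometries of `C` that normalise a commutative set. -/
theorem IsNormalisingPI.trace_eq_zero (hD : ∀ x ∈ D, ∀ y ∈ D, x * y = y * x) (h1 : 1 ∈ D)
    (hu : IsNormalisingPI D u) {n : ℕ} (hn : u ^ n = 0) {C : Set R}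
    (hC : ∀ x ∈ C, ∀ y ∈ C, x * y ∈ C) (huC : u ∈ C) (huC' : star u ∈ C) {E : Type*}
    {φ : R → E} (hφ : ∀ x ∈ C, ∀ y ∈ C, φ (x * y) = φ (y * x)) : φ u = φ 0 := by
  -- The range projections of the powers of `u` decrease and satisfy `u e k = e (k + 1) u`. With
  -- traciality this gives `φ (e (k + 1) u) = φ (e (k + 2) u)`, so `φ u = φ (e (k + 1) u)` for all
  -- `k`, until nilpotency makes `e (k + 1)` vanish. The indices start at `k + 1` because `C` is not
  -- assumed to contain `1 = e 0`.
  set e : ℕ → R := fun k => u ^ k * star (u ^ k) with he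
  have heD : ∀ k, e k ∈ D := fun k => (hu.pow hD h1 k).mul_star_mem h1
  have hpC : ∀ k, u ^ (k + 1) ∈ C := fun k => by
    induction k with
    | zero => simpa using huC
    | succ k ih => rw [pow_succ]; exact hC _ ih _ huC
  have hsC : ∀ k, star (u ^ (k + 1)) ∈ C := fun k => by
    induction k with
    | zero => simpa using huC'
    | succ k ih => rw [pow_succ, star_mul]; exact hC _ huC' _ ih
  have heC : ∀ k, e (k + 1) ∈ C := fun k => hC _ (hpC k) _ (hsC k)
  have hidem : ∀ k, e k * e k = e k := fun k => by
    simp only [he]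
    rw [← mul_assoc, (hu.pow hD h1 k).mul_star_mul]
  have hsucc : ∀ k, e (k + 1) = u * e k * star u := fun k => by
    simp only [he, pow_succ', star_mul, mul_assoc]
  have hcomm : ∀ k, u * e k = e (k + 1) * u := fun k => by
    rw [hsucc, mul_assoc (u * e k), mul_assoc u, hD _ (heD k) _ (hu.star_mul_mem h1),
      ← mul_assoc u (star u * u), ← mul_assoc u (star u), hu.mul_star_mul]
  have hstep : ∀ k, φ (e (k + 1) * u) = φ (e (k + 2) * u) := fun k => by
    have hle : e (k + 1) * e (k + 2) = e (k + 2) := by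
      simp only [he]
      rw [pow_succ u (k + 1), ← mul_assoc, ← mul_assoc, (hu.pow hD h1 (k + 1)).mul_star_mul]
    calc φ (e (k + 1) * u) = φ (e (k + 1) * (e (k + 1) * u)) := by rw [← mul_assoc, hidem]
      _ = φ (e (k + 1) * u * e (k + 1)) := hφ _ (heC k) _ (hC _ (heC k) _ huC)
      _ = φ (e (k + 2) * u) := by rw [mul_assoc, hcomm, ← mul_assoc, hle]
  have hall : ∀ k, φ u = φ (e (k + 1) * u) := fun k => by
    induction k with
    | zero => simp only [he, zero_add, pow_one]; rw [hu.mul_star_mul]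
    | succ k ih => rw [ih, hstep]
  rw [hall n]
  simp [he, pow_succ, hn]

end Normalising

/-! ### Spectral radius and nilpotency -/

theorem norm_eq_one_of_mul_star_mul {R : Type*} [NonUnitalNormedRing R] [StarRing R] [CStarRing R]
    {v : R} (hv : v * star v * v = v) (h0 : v ≠ 0) : ‖v‖ = 1 := by
  have h1 : star (star v * v) * (star v * v) = star v * v := by
    rw [star_mul, star_star, mul_assoc, ← mul_assoc v, hv]
  have h2 := CStarRing.norm_star_mul_self (x := star v * v)
  rw [h1, CStarRing.norm_star_mul_self] at h2
  have h3 : ‖v‖ ≠ 0 := norm_ne_zero_iff.2 h0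
  have h4 : ‖v‖ * ‖v‖ = 1 := by
    have := mul_ne_zero h3 h3
    exact mul_left_cancel₀ this (by rw [← h2, mul_one])
  nlinarith [norm_nonneg v]

/-- If all the powers of `u` are partial isometries and the spectral radius of `u` is less than
one, then `u` is nilpotent. -/
theorem exists_pow_eq_zero_of_spectralRadius_lt_one {R : Type*} [NormedRing R] [StarRing R]
    [CStarRing R] [NormedAlgebra ℂ R] [CompleteSpace R] {u : R}
    (hu : ∀ k, u ^ k * star (u ^ k) * u ^ k = u ^ k) (hr : spectralRadius ℂ u < 1) :
    ∃ n, u ^ n = 0 := by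
  by_contra! h
  -- If no power vanishes, Gelfand's sequence is constantly `1`; at `n = 0` the exponent `1 / 0` is
  -- `0` and the value is still `1`.
  have h1 : ∀ n : ℕ, (‖u ^ n‖₊ : ℝ≥0∞) ^ (1 / n : ℝ) = 1 := fun n => by
    have : ‖u ^ n‖₊ = 1 := NNReal.eq (norm_eq_one_of_mul_star_mul (hu n) (h n))
    rw [this, ENNReal.coe_one, ENNReal.one_rpow]
  have h2 := spectrum.pow_nnnorm_pow_one_div_tendsto_nhds_spectralRadius u
  simp only [h1] at h2
  exact hr.ne (tendsto_nhds_unique h2 tendsto_const_nhds)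

/-! ### Product forms are tracial -/

/-- Polarization at `x + y` and `x + iy`, after subtracting the values at `x` and `y`. Two forms are
allowed because in the application `f` and `g` carry the products of the other tensor legs in
opposite orders. -/
theorem polarization_star {R : Type*} [Ring R] [StarRing R] [Algebra ℂ R] [StarModule ℂ R]
    {S : Submodule ℂ R} {f g : R →ₗ[ℂ] ℂ} (h : ∀ y ∈ S, f (star y * y) = g (y * star y))
    {x y : R} (hx : x ∈ S) (hy : y ∈ S) : f (star y * x) = g (x * star y) := by
  have h1 := h (x + y) (S.add_mem hx hy)
  have h2 := h (x + Complex.I • y) (S.add_mem hx (S.smul_mem _ hy))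
  have hx := h x hx
  have hy := h y hy
  simp only [star_add, star_smul, add_mul, mul_add, map_add, smul_mul_assoc, mul_smul_comm,
    map_smul, smul_eq_mul, Complex.star_def, Complex.conj_I] at h1 h2
  linear_combination (1 / 2 : ℂ) * h1 + (Complex.I / 2) * h2 - (1 + Complex.I) / 2 * (hx + hy)
    + ((f (star y * x) - f (star x * y) + g (y * star x) - g (x * star y)) / 2
      + Complex.I / 2 * (f (star y * y) - g (y * star y))) * Complex.I_sq

section Forms

variable {H : Type*} [NormedAddCommGroup H] [InnerProductSpace ℂ H] [CompleteSpace H]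
variable {K : Type*} [NormedAddCommGroup K] [InnerProductSpace ℂ K] [CompleteSpace K]
variable {L : Type*} [NormedAddCommGroup L] [InnerProductSpace ℂ L] [CompleteSpace L]
variable {M : VonNeumannAlgebra H} {tr : (H →L[ℂ] H) → ℝ≥0∞} {p : H →L[ℂ] H}

/-- The corner `p M p` as a subspace. -/
def cornerSubmodule (M : VonNeumannAlgebra H) (p : H →L[ℂ] H) : Submodule ℂ (H →L[ℂ] H) where
  carrier := corner M p
  add_mem' := by
    rintro _ _ ⟨y, hy, rfl⟩ ⟨z, hz, rfl⟩
    exact ⟨y + z, add_mem hy hz, by noncomm_ring⟩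
  zero_mem' := ⟨0, zero_mem _, by simp⟩
  smul_mem' := by
    rintro c _ ⟨y, hy, rfl⟩
    exact ⟨c • y, M.toStarSubalgebra.smul_mem hy c, by simp⟩

theorem corner_subset (hp : IsProj M p) {x : H →L[ℂ] H} (hx : x ∈ corner M p) : x ∈ M := by
  obtain ⟨y, hy, rfl⟩ := hx
  exact mul_mem (mul_mem hp.1 hy) hp.1

theorem mul_mem_corner (hp : IsProj M p) {x y : H →L[ℂ] H} (hx : x ∈ corner M p)
    (hy : y ∈ corner M p) : x * y ∈ corner M p := by
  obtain ⟨a, ha, rfl⟩ := hx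
  obtain ⟨b, hb, rfl⟩ := hy
  exact ⟨a * p * p * b, mul_mem (mul_mem (mul_mem ha hp.1) hp.1) hb, by noncomm_ring⟩

theorem star_mem_corner (hp : IsProj M p) {x : H →L[ℂ] H} (hx : x ∈ corner M p) :
    star x ∈ corner M p := by
  obtain ⟨a, ha, rfl⟩ := hx
  have h : star p = p := hp.2.isSelfAdjoint
  exact ⟨star a, star_mem ha, by simp [h, mul_assoc]⟩

theorem mul_mul_eq_of_mem_corner (hp : IsProj M p) {x : H →L[ℂ] H} (hx : x ∈ corner M p) :
    p * x * p = x := by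
  obtain ⟨a, ha, rfl⟩ := hx
  have h : p * p = p := hp.2.isIdempotentElem
  rw [mul_assoc p a p, ← mul_assoc p p, h, mul_assoc, mul_assoc, h]

variable {A : VonNeumannAlgebra K} {α : A.toStarSubalgebra →ₗ[ℂ] ℂ}
variable {B : VonNeumannAlgebra L} {β : B.toStarSubalgebra →ₗ[ℂ] ℂ}
variable {φ : (HTensor (HTensor H K) L →L[ℂ] HTensor (HTensor H K) L) →ₗ[ℂ] ℂ}

/-- By continuity simple tensors suffice. There `α` and `β` handle the last two legs. For the first,
`φ` is prescribed only at positive elements, where `tr (y*y) = tr (yy*)`, and polarization does the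
rest. -/
theorem IsProductForm₃.trace_comm (hφ : IsProductForm₃ M tr p A α B β φ) (htr : IsTrace M tr)
    (hp : IsProj M p) (hα : ∀ x y, α (x * y) = α (y * x)) (hβ : ∀ x y, β (x * y) = β (y * x))
    {y z : HTensor (HTensor H K) L →L[ℂ] HTensor (HTensor H K) L}
    (hy : y ∈ vnTensor₃ (corner M p) (A : Set (K →L[ℂ] K)) (B : Set (L →L[ℂ] L)))
    (hz : z ∈ vnTensor₃ (corner M p) (A : Set (K →L[ℂ] K)) (B : Set (L →L[ℂ] L))) :
    φ (y * z) = φ (z * y) := by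
  refine trace_comm_swSpan hφ.1 ?_ hy hz
  rintro _ ⟨x, hx, a, ha, b, hb, rfl⟩ _ ⟨x', hx', a', ha', b', hb', rfl⟩
  simp only [opTensor_mul]
  let f : (H →L[ℂ] H) →ₗ[ℂ] ℂ := φ ∘ₗ opTensorLeft _ (b * b') ∘ₗ opTensorLeft H (a * a')
  let g : (H →L[ℂ] H) →ₗ[ℂ] ℂ := φ ∘ₗ opTensorLeft _ (b' * b) ∘ₗ opTensorLeft H (a' * a)
  let a₁ : A.toStarSubalgebra := ⟨a, ha⟩
  let a₂ : A.toStarSubalgebra := ⟨a', ha'⟩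
  let b₁ : B.toStarSubalgebra := ⟨b, hb⟩
  let b₂ : B.toStarSubalgebra := ⟨b', hb'⟩
  have h : ∀ y ∈ cornerSubmodule M p, f (star y * y) = g (y * star y) := fun y hy => by
    have hy' := star_mem_corner hp hy
    have hm := mul_mem_corner hp hy' hy
    have hm' := mul_mem_corner hp hy hy'
    have e1 : f (star y * y) = _ := hφ.2 (star y * y) (corner_subset hp hm)
      (star_mul_self_nonneg y) (a₁ * a₂) (b₁ * b₂)
    have e2 : g (y * star y) = _ := hφ.2 (y * star y) (corner_subset hp hm')
      (mul_star_self_nonneg y) (a₂ * a₁) (b₂ * b₁)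
    rw [e1, e2, mul_mul_eq_of_mem_corner hp hm, mul_mul_eq_of_mem_corner hp hm',
      htr.tracial y (corner_subset hp hy), hα a₁, hβ b₁]
  have := polarization_star h hx' (star_mem_corner hp hx)
  rwa [star_star] at this

theorem productForm₃_trace_comm (htr : IsTrace M tr)
    (hp : IsProj M p) (hα : ∀ x y, α (x * y) = α (y * x)) (hβ : ∀ x y, β (x * y) = β (y * x))
    {y z : HTensor (HTensor H K) L →L[ℂ] HTensor (HTensor H K) L}
    (hy : y ∈ vnTensor₃ (corner M p) (A : Set (K →L[ℂ] K)) (B : Set (L →L[ℂ] L)))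
    (hz : z ∈ vnTensor₃ (corner M p) (A : Set (K →L[ℂ] K)) (B : Set (L →L[ℂ] L))) :
    productForm₃ M tr p A α B β (y * z) = productForm₃ M tr p A α B β (z * y) := by
  rw [productForm₃]
  split_ifs with h
  · exact h.choose_spec.trace_comm htr hp hα hβ hy hz
  -- If no product form exists, `productForm₃` is the zero form.
  · rfl

end Forms

/-! ### Promising projects -/

section Promising

variable {H : Type u} [NormedAddCommGroup H] [InnerProductSpace ℂ H] [CompleteSpace H]
variable {M : VonNeumannAlgebra H} {tr : (H →L[ℂ] H) → ℝ≥0∞} {p : H →L[ℂ] H}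
variable {P : VonNeumannAlgebra H}

theorem ldet_eq_zero (htr : IsTrace M tr) (hp : IsProj M p) (hP : IsAbelian P)
    {f g : Project.{u, v} M p} (hf : IsPromising tr P f) (hg : IsPromising tr P g)
    (hr : spectralRadius ℂ (interaction f g) < 1) : ldet tr f g = 0 := by
  obtain ⟨Q, hQ, hfs, hfn, -⟩ := hf.symmetry_traces
  obtain ⟨Q', hQ', hgs, hgn, -⟩ := hg.symmetry_traces
  -- Two different algebras are at work: the commutative unital `D` is what the operators normalise,
  -- while the corner `C` contains them and is where the product form is tracial.
  set D := vnTensor₃ (P : Set (H →L[ℂ] H)) (Q : Set (f.K →L[ℂ] f.K)) (Q' : Set (g.K →L[ℂ] g.K))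
    with hD
  set C := vnTensor₃ (corner M p) (f.dialect : Set (f.K →L[ℂ] f.K))
    (g.dialect : Set (g.K →L[ℂ] g.K)) with hC
  have hDc : ∀ x ∈ D, ∀ y ∈ D, x * y = y * x := fun x hx y hy =>
    commute_vnTensor₃ hP hQ.2.1 hQ'.2.1 hx hy
  have hD1 : 1 ∈ D := subset_swSpan _ ⟨1, one_mem P, 1, one_mem Q, 1, one_mem Q', by
    rw [opTensor_one, opTensor_one]⟩
  have hCm : ∀ x ∈ C, ∀ y ∈ C, x * y ∈ C := fun x hx y hy =>
    mul_mem_vnTensor₃ (fun _ h _ h' => mul_mem_corner hp h h') (fun _ h _ h' => mul_mem h h')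
      (fun _ h _ h' => mul_mem h h') hx hy
  have hfC : dagger g.K f.op ∈ C := opTensor_mem_vnTensor₃ f.op_mem (one_mem g.dialect)
  have hgC : ddagger f.K g.op ∈ C := swapConj_opTensor_mem_vnTensor₃ g.op_mem (one_mem f.dialect)
  have hfstar : star (dagger g.K f.op) = dagger g.K f.op := by
    rw [dagger, star_opTensor, hfs.1, star_one]
  have hgstar : star (ddagger f.K g.op) = ddagger f.K g.op := by
    rw [ddagger_eq_swapConj, star_swapConj, star_opTensor, hgs.1, star_one]
  have hfN : IsNormalisingPI D (dagger g.K f.op) := by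
    refine .of_isSelfAdjoint hfstar ?_ fun d hd => dagger_mul_mul_dagger_mem (fun a ha => ?_) hd
    · rw [hfstar, dagger, opTensor_mul, opTensor_mul, one_mul, one_mul]
      exact congrArg (opTensor · 1) (by simpa only [hfs.1] using hfs.2)
    · simpa only [hfs.1] using hfn.2.2.2.2 a ha
  have hgN : IsNormalisingPI D (ddagger f.K g.op) := by
    refine .of_isSelfAdjoint hgstar ?_ fun d hd => ddagger_mul_mul_ddagger_mem (fun a ha => ?_) hd
    · rw [hgstar, ddagger_eq_swapConj, swapConj_mul, swapConj_mul, opTensor_mul, opTensor_mul,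
        one_mul, one_mul]
      exact congrArg (fun z => swapConj _ _ _ (opTensor z 1)) (by simpa only [hgs.1] using hgs.2)
    · simpa only [hgs.1] using hgn.2.2.2.2 a ha
  have huN : IsNormalisingPI D (interaction f g) := hfN.mul hDc hD1 hgN
  have huC : interaction f g ∈ C := hCm _ hfC _ hgC
  have huC' : star (interaction f g) ∈ C := by
    rw [interaction, star_mul, hfstar, hgstar]
    exact hCm _ hgC _ hfC
  obtain ⟨n, hn⟩ := exists_pow_eq_zero_of_spectralRadius_lt_one
    (fun k => (huN.pow hDc hD1 k).mul_star_mul) hr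
  have hpow : ∀ x ∈ C, ∀ k : ℕ, x ^ (k + 1) ∈ C := fun x hx k => by
    induction k with
    | zero => simpa using hx
    | succ k ih => rw [pow_succ]; exact hCm _ ih _ hx
  have hzero : ∀ k : ℕ, productForm₃ M tr p f.dialect f.form g.dialect g.form
      (interaction f g ^ (k + 1)) = 0 := fun k => by
    -- Each power `u ^ (k + 1)` is itself a normalising partial isometry in `C`, and is nilpotent
    -- since `(u ^ (k + 1)) ^ n = (u ^ n) ^ (k + 1)`.
    rw [(huN.pow hDc hD1 (k + 1)).trace_eq_zero hDc hD1 (n := n)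
      (by rw [pow_right_comm, hn, zero_pow k.succ_ne_zero]) hCm (hpow _ huC k)
      (by rw [star_pow]; exact hpow _ huC' k)
      (fun x hx y hy => productForm₃_trace_comm htr hp f.isPseudoTrace.tracial
        g.isPseudoTrace.tracial hx hy), map_zero]
  simp [ldet, hzero]

theorem not_orthogonal_of_isPromising (htr : IsTrace M tr) (hp : IsProj M p) (hP : IsAbelian P)
    {f g : Project.{u, v} M p} (hf : IsPromising tr P f) (hg : IsPromising tr P g) :
    ¬ Orthogonal tr f g := by
  rintro ⟨h0, h1⟩
  have hm : measure tr f g = opMeasure tr f g := by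
    simp [measure, hf.wager_eq, hg.wager_eq]
  rw [hm, opMeasure] at h0 h1
  split_ifs at h0 h1 with hr
  · exact h0 (by simp [ldet_eq_zero htr hp hP hf hg hr])
  · exact h1 rfl

end Promising

end MatGoI

end

theorem mainTheorem6 {H : Type u} [NormedAddCommGroup H] [InnerProductSpace ℂ H]
    [CompleteSpace H] [TopologicalSpace.SeparableSpace H]
    (M : VonNeumannAlgebra H) (hM : MatGoI.IsFactorIIInfty M) (hM' : MatGoI.IsHyperfinite M)
    (tr : (H →L[ℂ] H) → ℝ≥0∞) (htr : MatGoI.IsTrace M tr)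
    (P : VonNeumannAlgebra H) (hP : MatGoI.IsMASA P M)
    (p : H →L[ℂ] H) (hp : MatGoI.IsFiniteProj M p)
    (A : Set (MatGoI.Project.{u, v} M p)) (hA : MatGoI.IsConduct tr A) :
    ¬ ((∃ f ∈ A, MatGoI.IsPromising tr P f) ∧
      (∃ g ∈ MatGoI.orth tr A, MatGoI.IsPromising tr P g)) := by
  rintro ⟨⟨f, hfA, hf⟩, g, hg, hg'⟩
  exact MatGoI.not_orthogonal_of_isPromising htr hp.1 hP.2.1 hf hg' (hg f hfA)
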